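/- Let $\{\psi^\varepsilon\}_{0<\varepsilon\le 1}\subset H^1(\mathbb R^d;\mathbb C)$ satisfy $\sup_{0<\varepsilon\le 1}\big(\|\psi^\varepsilon\|_{L^2}+\|\varepsilon\nabla\psi^\varepsilon\|_{L^2}\big)<\infty$, and put $\rho^\varepsilon=|\psi^\varepsilon|^2$, $J^\varepsilon=\varepsilon\,\mathrm{Im}(\overline{\psi^\varepsilon}\nabla\psi^\varepsilon)$. Let $\beta^\varepsilon$ be the Bohmian measure on $\mathbb R^d_x\times\mathbb R^d_p$, given by $\langle\beta^\varepsilon,\varphi\rangle=\int_{\mathbb R^d}\rho^\varepsilon(x)\,\varphi\big(x,J^\varepsilon(x)/\rho^\varepsilon(x)\big)\,dx$ for $\varphi\in C_0(\mathbb R^d_x\times\mathbb R^d_p)$. Let $\varepsilon_n\in(0,1]$, $\varepsilon_n\to0$, be a sequence along which $\beta^{\varepsilon_n}$ converges weakly-$*$ (tested against $C_0(\mathbb R^d_x\times\mathbb R^d_p)$) to a finite non-negative Borel measure $\beta$. Then there are a subsequence $(\varepsilon_{n_k})_k$ and a measurable family $(\mu_x)_{x\in\mathbb R^d}$ of non-negative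 Borel measures on $\mathbb R_r\times\mathbb R^d_\xi$ with $\mu_x(\mathbb R^{1+d})\le1$ which is the Young measure associated to the sequence $(\rho^{\varepsilon_{n_k}},J^{\varepsilon_{n_k}})_k$, i.e. $$\lim_{k\to\infty}\int_{\mathbb R^d}\sigma\big(x,\rho^{\varepsilon_{n_k}}(x),J^{\varepsilon_{n_k}}(x)\big)\,dx=\int_{\mathbb R^d}\int_{\mathbb R^{1+d}}\sigma(x,r,\xi)\,d\mu_x(r,\xi)\,dx\qquad\text{for all }\sigma\in L^1\big(\mathbb R^d;C_0(\mathbb R^{1+d})\big),$$ such that $$\beta(x,p)\ \ge\ \int_0^\infty r^{d+1}\mu_x(r,rp)\,dr$$ in the sense of measures. Here the right-hand side denotes (formally, by the change of variables $\xi=rp$) the non-negative measure on $\mathbb R^d_x\times\mathbb R^d_p$ whose integral against $\varphi\ge 0$ is $\int_{\mathbb R^d}\int_{\{r>0\}} r\,\varphi(x,\xi/r)\,d\mu_x(r,\xi)\,dx$. If moreover $\rho^{\varepsilon_{n_k}}\rightharpoonup\rho$ weakly in $L^1(\mathbb R^d)$ as $k\to\infty$ for some $\rho\in L^1(\mathbb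 R^d)$ (in particular if $\rho^\varepsilon\rightharpoonup\rho$ weakly in $L^1$ as $\varepsilon\to0_+$), then equality holds and $\mu_x$ is a probability measure for a.e. $x\in\mathbb R^d$. -/

import Mathlib

open MeasureTheory ProbabilityTheory Filter Topology Set
open scoped ENNReal ContDiff ZeroAtInfty

noncomputable section

namespace BohmianYoung

/-- The Euclidean space `ℝ^d`. -/
abbrev RSpace (d : ℕ) : Type := EuclideanSpace ℝ (Fin d)

/-- `G` is a weak gradient of `ψ : ℝ^d → ℂ`: one has `∫ ψ ∂ⱼφ = - ∫ φ Gⱼ` for all test functions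
`φ ∈ C_c^∞(ℝ^d)` and all `j`. Only used for `ψ` and `G` in `L²`. -/
def HasWeakGradient {d : ℕ} (ψ : RSpace d → ℂ) (G : RSpace d → EuclideanSpace ℂ (Fin d)) : Prop :=
  ∀ φ : RSpace d → ℝ, ContDiff ℝ ∞ φ → HasCompactSupport φ → ∀ j : Fin d,
    ∫ x, ((fderiv ℝ φ x (EuclideanSpace.single j 1) : ℝ) : ℂ) * ψ x
      = - ∫ x, ((φ x : ℝ) : ℂ) * G x j

/-- The Sobolev space `H¹(ℝ^d; ℂ)`: `ψ ∈ L²` with a weak gradient in `L²`. -/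
def MemH1 {d : ℕ} (ψ : RSpace d → ℂ) : Prop :=
  MemLp ψ 2 volume ∧ ∃ G : RSpace d → EuclideanSpace ℂ (Fin d),
    MemLp G 2 volume ∧ HasWeakGradient ψ G

open scoped Classical in
/-- The weak gradient `∇ψ ∈ L²` of `ψ ∈ H¹(ℝ^d; ℂ)`, which is unique up to null sets
(with the value `0` for `ψ ∉ H¹`). -/
def weakGradient {d : ℕ} (ψ : RSpace d → ℂ) : RSpace d → EuclideanSpace ℂ (Fin d) :=
  if h : ∃ G : RSpace d → EuclideanSpace ℂ (Fin d), MemLp G 2 volume ∧ HasWeakGradient ψ G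
  then h.choose else 0

/-- The scaled norm `‖ψ‖_{L²} + ‖ε ∇ψ‖_{L²}` of `ψ ∈ H¹(ℝ^d; ℂ)`. -/
def H1epsNorm {d : ℕ} (ε : ℝ) (ψ : RSpace d → ℂ) : ℝ≥0∞ :=
  eLpNorm ψ 2 volume + eLpNorm (fun x => (ε : ℂ) • weakGradient ψ x) 2 volume

/-- The family `ψ^ε`, `0 < ε ≤ 1`, lies in `H¹` and its scaled norms are bounded uniformly
in `ε`. -/
def UniformlyBoundedH1eps {d : ℕ} (ψ : ℝ → RSpace d → ℂ) : Prop :=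
  (∀ ε ∈ Ioc (0 : ℝ) 1, MemH1 (ψ ε)) ∧ (⨆ ε ∈ Ioc (0 : ℝ) 1, H1epsNorm ε (ψ ε)) < ⊤

/-- The position density `ρ = |ψ|²`. -/
def density {d : ℕ} (ψ : RSpace d → ℂ) (x : RSpace d) : ℝ := ‖ψ x‖ ^ 2

/-- The current density `J = ε Im (conj ψ ∇ψ)`. -/
def current {d : ℕ} (ε : ℝ) (ψ : RSpace d → ℂ) (x : RSpace d) : RSpace d :=
  WithLp.toLp 2 fun j => ε * (starRingEnd ℂ (ψ x) * weakGradient ψ x j).im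

/-- The Bohmian measure `β^ε = ρ(x) δ(p - J(x)/ρ(x))` on phase space `ℝ^d × ℝ^d`: the image of
`ρ dx` under `x ↦ (x, J(x)/ρ(x))`, that is `⟨β^ε, φ⟩ = ∫ ρ(x) φ(x, J(x)/ρ(x)) dx`.
(The zeros of `ρ` form a null set for `ρ dx`.) -/
def bohmianMeasure {d : ℕ} (ε : ℝ) (ψ : RSpace d → ℂ) : Measure (RSpace d × RSpace d) :=
  (volume.withDensity fun x => ENNReal.ofReal (density ψ x)).map
    fun x => (x, (density ψ x)⁻¹ • current ε ψ x)

/-- Weak-`*` convergence of (finite) measures, as functionals on `C₀`. -/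
def TendstoWeakStar {X : Type*} [TopologicalSpace X] [MeasurableSpace X]
    (β : ℕ → Measure X) (β₀ : Measure X) : Prop :=
  ∀ φ : C₀(X, ℝ), Tendsto (fun n => ∫ z, φ z ∂(β n)) atTop (𝓝 (∫ z, φ z ∂β₀))

/-- Weak convergence in `L¹(ℝ^d)`, tested against `L^∞(ℝ^d)`. -/
def TendstoWeakL1 {d : ℕ} (u : ℕ → RSpace d → ℝ) (u₀ : RSpace d → ℝ) : Prop :=
  (∀ n, Integrable (u n) volume) ∧ Integrable u₀ volume ∧
    ∀ g : RSpace d → ℝ, MemLp g ⊤ volume →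
      Tendsto (fun n => ∫ x, u n x * g x) atTop (𝓝 (∫ x, u₀ x * g x))

/-- `μ = (μ_x)` is the Young measure associated to the sequence `f_n : ℝ^d → Y`: a measurable
family of non-negative measures on `Y` of mass at most one such that
`∫ σ(x, f_n(x)) dx → ∫ ∫ σ(x, y) dμ_x(y) dx` for every `σ ∈ L¹(ℝ^d; C₀(Y))`. -/
structure IsYoungMeasure {d : ℕ} {Y : Type*} [TopologicalSpace Y] [MeasurableSpace Y]
    (f : ℕ → RSpace d → Y) (μ : Kernel (RSpace d) Y) : Prop where
  mass_le_one : ∀ x, μ x univ ≤ 1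
  tendsto : ∀ σ : RSpace d → C₀(Y, ℝ), Integrable σ volume →
    Tendsto (fun n => ∫ x, σ x (f n x)) atTop (𝓝 (∫ x, ∫ y, σ x y ∂(μ x)))

/-- The measure on phase space formally written `∫₀^∞ r^{d+1} μ_x(r, r p) dr`, for a family `μ_x`
of measures on `ℝ_r × ℝ^d_ξ`. After the change of variables `ξ = r p`, `dξ = r^d dp`, its integral
of `φ` is `∫ ∫_{r > 0} r φ(x, ξ / r) dμ_x(r, ξ) dx`: it is the image of the measure
`r⁺ dμ_x(r, ξ) dx` (which does not charge `r ≤ 0`) under `(x, r, ξ) ↦ (x, ξ / r)`. -/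
def youngMoment {d : ℕ} (μ : Kernel (RSpace d) (ℝ × RSpace d)) :
    Measure (RSpace d × RSpace d) :=
  (((volume : Measure (RSpace d)) ⊗ₘ μ).withDensity fun z => ENNReal.ofReal z.2.1).map
    fun z => (z.1, z.2.1⁻¹ • z.2.2)

end BohmianYoung

end

open BohmianYoung

/-!
The limit of the pairs `(ρ, J)` is found on the graph. Fix a probability measure `P = g dx` with a
continuous positive bounded density `g`, and push `P` forward under `x ↦ (x, ρₙ(x), Jₙ(x))`. As `ρₙ`
and `Jₙ` are bounded in `L¹` (because `|J| ≤ |ψ| |ε ∇ψ|`), Markov's inequality makes these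
probability measures tight, and Prokhorov's theorem gives a narrowly convergent subsequence. Its
limit has first marginal `P`, hence disintegrates as `P ⊗ₘ μ` with a Markov kernel `μ`
(`exists_kernel_narrow_limit`). So no mass escapes to infinity and all `μ_x` are probability
measures. Dividing test functions by `g` replaces `P` by Lebesgue measure (`exists_narrowLimit`),
and the density of continuous compactly supported maps in `L¹(ℝ^d; C₀)` shows that `μ` is the Young
measure (`NarrowLimit.isYoungMeasure`).

The Bohmian measure integrates `φ ∈ C_c` to `∫ ρ φ(x, J/ρ) dx`. The integrand `r⁺ φ(x, ξ/r)` is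
continuous in `(x, r, ξ)`, also at `r = 0`, but it is unbounded in `r`; its truncation
`min(r⁺, K) φ(x, ξ/r)` (`cutoffMoment`) is bounded, so narrow convergence applies to it. For
`φ ≥ 0` truncating decreases the integral, and letting `K → ∞` gives the inequality
(`lintegral_youngMoment_le`).

If `ρₙ` converges weakly in `L¹`, then `ρₙ` is equi-integrable, which for non-negative functions has
a short proof (`TendstoWeakL1.exists_setIntegral_le`). The truncation error is then small uniformly
in `n`, and the opposite inequality holds (`lintegral_le_lintegral_youngMoment`).
-/

namespace BohmianYoung

/-! ### Young measures from narrow compactness -/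

/-- Compactness for a sequence of maps with tight values: the images of `P` under `x ↦ (x, f n x)`
converge narrowly, along a subsequence, to `P ⊗ₘ κ` for a Markov kernel `κ`. -/
theorem exists_kernel_narrow_limit {X Y : Type*} [TopologicalSpace X] [PolishSpace X]
    [MeasurableSpace X] [BorelSpace X] [TopologicalSpace Y] [PolishSpace Y] [MeasurableSpace Y]
    [BorelSpace Y] [Nonempty Y] (P : Measure X) [IsProbabilityMeasure P] (f : ℕ → X → Y)
    (hf : ∀ n, AEMeasurable (f n) P)
    (htight : ∀ δ : ℝ≥0∞, 0 < δ → ∃ K : Set Y, IsCompact K ∧ ∀ n, P {x | f n x ∉ K} ≤ δ) :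
    ∃ (k : ℕ → ℕ) (κ : Kernel X Y), StrictMono k ∧ IsMarkovKernel κ ∧
      ∀ h : BoundedContinuousFunction (X × Y) ℝ,
        Tendsto (fun n => ∫ x, h (x, f (k n) x) ∂P) atTop (𝓝 (∫ z, h z ∂(P ⊗ₘ κ))) := by
  have hfg (n : ℕ) : AEMeasurable (fun x => (x, f n x)) P := aemeasurable_id.prodMk (hf n)
  let ν : ℕ → ProbabilityMeasure (X × Y) := fun n =>
    ⟨P.map fun x => (x, f n x), Measure.isProbabilityMeasure_map (hfg n)⟩
  have hν (n : ℕ) : (ν n : Measure (X × Y)) = P.map fun x => (x, f n x) := rfl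
  have hν_fst (n : ℕ) : (ν n : Measure (X × Y)).fst = P := by
    rw [hν, Measure.fst_map_prodMk₀ (hf n)]
    exact Measure.map_id
  have ht : IsTightMeasureSet {((μ : ProbabilityMeasure (X × Y)) : Measure (X × Y)) |
      μ ∈ range ν} := by
    apply IsTightMeasureSet.prodMk
    · refine (isTightMeasureSet_singleton (μ := P)).subset ?_
      rintro _ ⟨_, ⟨_, ⟨n, rfl⟩, rfl⟩, rfl⟩
      exact hν_fst n
    · rw [isTightMeasureSet_iff_exists_isCompact_measure_compl_le]
      intro δ hδ
      obtain ⟨K, hK, hKle⟩ := htight δ hδ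
      refine ⟨K, hK, ?_⟩
      rintro _ ⟨_, ⟨_, ⟨n, rfl⟩, rfl⟩, rfl⟩
      rw [hν, Measure.snd_map_prodMk₀ (X := fun x => x) aemeasurable_id,
        Measure.map_apply_of_aemeasurable (hf n) hK.measurableSet.compl]
      exact hKle n
  obtain ⟨ν₀, -, k, hk, hlim⟩ := (isCompact_closure_of_isTightMeasureSet ht).isSeqCompact
    (fun n => subset_closure (mem_range_self n))
  rw [ProbabilityMeasure.tendsto_iff_forall_integral_tendsto] at hlim
  have hfst : (ν₀ : Measure (X × Y)).fst = P := by
    have : IsFiniteMeasure (ν₀ : Measure (X × Y)).fst := inferInstance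
    refine ext_of_forall_integral_eq_of_IsFiniteMeasure fun h => ?_
    have h1 := hlim (h.compContinuous ⟨Prod.fst, continuous_fst⟩)
    have h2 (μ : Measure (X × Y)) :
        ∫ z, h.compContinuous ⟨Prod.fst, continuous_fst⟩ z ∂μ = ∫ x, h x ∂μ.fst := by
      rw [Measure.fst, integral_map measurable_fst.aemeasurable
        h.continuous.measurable.aestronglyMeasurable]
      rfl
    simp only [Function.comp_apply, h2, hν_fst] at h1
    exact tendsto_nhds_unique h1 tendsto_const_nhds
  refine ⟨k, (ν₀ : Measure (X × Y)).condKernel, hk, inferInstance, fun h => ?_⟩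
  have hdis : P ⊗ₘ (ν₀ : Measure (X × Y)).condKernel = ν₀ := by
    conv_lhs => rw [← hfst]
    exact (ν₀ : Measure (X × Y)).disintegrate _
  rw [hdis]
  refine (hlim h).congr fun n => ?_
  rw [Function.comp_apply, hν, integral_map (hfg _) h.continuous.measurable.aestronglyMeasurable]

theorem exists_probability_weight (d : ℕ) : ∃ g : RSpace d → ℝ, Continuous g ∧ (∀ x, 0 < g x) ∧
    (∃ C : ℝ, ∀ x, g x ≤ C) ∧ ∫⁻ x, ENNReal.ofReal (g x) = 1 := by
  let w : RSpace d → ℝ := fun x => (1 + ‖x‖) ^ (-((d : ℝ) + 1))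
  have hpos (x : RSpace d) : 0 < w x := by positivity
  have hint : Integrable w volume := by
    apply integrable_one_add_norm
    simp
  have hcont : Continuous w := by
    refine Continuous.rpow_const (by fun_prop) fun x => Or.inl ?_
    positivity
  have hI : 0 < ∫ x, w x := by
    rw [integral_pos_iff_support_of_nonneg (fun x => (hpos x).le) hint]
    have : Function.support w = univ := eq_univ_of_forall fun x => (hpos x).ne'
    rw [this]
    exact isOpen_univ.measure_pos _ univ_nonempty
  refine ⟨fun x => (∫ x, w x)⁻¹ * w x, by fun_prop, fun x => by have := hpos x; positivity,
    ⟨(∫ x, w x)⁻¹, fun x => ?_⟩, ?_⟩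
  · refine mul_le_of_le_one_right (by positivity) ?_
    apply Real.rpow_le_one_of_one_le_of_nonpos
    · linarith [norm_nonneg x]
    · linarith [(d.cast_nonneg : (0 : ℝ) ≤ d)]
  · rw [← ofReal_integral_eq_lintegral_ofReal (hint.const_mul _)
      (ae_of_all _ fun x => by have := hpos x; positivity), integral_const_mul,
      inv_mul_cancel₀ hI.ne', ENNReal.ofReal_one]

/-- The kernel `κ` describes the limiting distribution of the values of `f n`: one has
`∫ H(x, f n x) dx → ∫ ∫ H(x, y) dκ_x(y) dx` for every bounded continuous `H` on `ℝ^d × Y` whose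
support is compact in the first variable. No decay of `H` in `y` is asked for, so that, unlike
`IsYoungMeasure`, this forbids a loss of mass at infinity in `Y`. -/
def NarrowLimit {d : ℕ} {Y : Type*} [TopologicalSpace Y] [MeasurableSpace Y]
    (f : ℕ → RSpace d → Y) (κ : Kernel (RSpace d) Y) : Prop :=
  ∀ H : RSpace d × Y → ℝ, Continuous H → (∃ C, ∀ z, |H z| ≤ C) →
    (∃ K : Set (RSpace d), IsCompact K ∧ ∀ x ∉ K, ∀ y, H (x, y) = 0) →
    Tendsto (fun n => ∫ x, H (x, f n x)) atTop (𝓝 (∫ z, H z ∂(volume ⊗ₘ κ)))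

theorem integrable_compProd_of_bounded {d : ℕ} {Y : Type*} [TopologicalSpace Y]
    [SecondCountableTopology Y] [MeasurableSpace Y] [BorelSpace Y] (κ : Kernel (RSpace d) Y)
    [IsMarkovKernel κ] {H : RSpace d × Y → ℝ} (hH : Continuous H) {C : ℝ} (hC : ∀ z, |H z| ≤ C)
    {K : Set (RSpace d)} (hK : IsCompact K) (hKH : ∀ x ∉ K, ∀ y, H (x, y) = 0) :
    Integrable H (volume ⊗ₘ κ) := by
  have hb : Integrable ((K ×ˢ (univ : Set Y)).indicator fun _ => C) (volume ⊗ₘ κ) := by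
    rw [integrable_indicator_iff (hK.measurableSet.prod .univ)]
    refine integrableOn_const ?_
    rw [Measure.compProd_apply_prod hK.measurableSet .univ]
    simpa using hK.measure_lt_top.ne
  refine hb.mono' hH.aestronglyMeasurable (ae_of_all _ fun ⟨x, y⟩ => ?_)
  by_cases hx : x ∈ K
  · simpa [indicator, hx] using hC (x, y)
  · simp [hx, hKH x hx y]

theorem exists_narrowLimit {d : ℕ} {Y : Type*} [TopologicalSpace Y] [PolishSpace Y]
    [MeasurableSpace Y] [BorelSpace Y] [Nonempty Y] (f : ℕ → RSpace d → Y)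
    (hf : ∀ n, AEMeasurable (f n) volume)
    (htight : ∀ δ : ℝ≥0∞, 0 < δ →
      ∃ K : Set Y, IsCompact K ∧ ∀ n, volume {x | f n x ∉ K} ≤ δ) :
    ∃ (k : ℕ → ℕ) (κ : Kernel (RSpace d) Y), StrictMono k ∧ IsMarkovKernel κ ∧
      NarrowLimit (fun n => f (k n)) κ := by
  obtain ⟨g, hg, hg0, ⟨C, hgC⟩, hg1⟩ := exists_probability_weight d
  have hgm : Measurable fun x => ENNReal.ofReal (g x) := by fun_prop
  let P : Measure (RSpace d) := volume.withDensity fun x => ENNReal.ofReal (g x)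
  have : IsProbabilityMeasure P := ⟨by simp [P, hg1]⟩
  have hPint (u : RSpace d → ℝ) : ∫ x, u x ∂P = ∫ x, g x * u x := by
    simp only [P]
    rw [integral_withDensity_eq_integral_toReal_smul hgm (by simp)]
    simp [ENNReal.toReal_ofReal (hg0 _).le]
  have hPle : P ≤ ENNReal.ofReal C • volume := by
    rw [← withDensity_const]
    exact withDensity_mono (ae_of_all _ fun x => ENNReal.ofReal_le_ofReal (hgC x))
  obtain ⟨k, κ, hk, hκ, hlim⟩ := exists_kernel_narrow_limit P f
    (fun n => (hf n).mono_ac (withDensity_absolutelyContinuous _ _)) (by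
      intro δ hδ
      obtain ⟨K, hK, hKδ⟩ := htight (δ / ENNReal.ofReal C)
        (ENNReal.div_pos hδ.ne' ENNReal.ofReal_ne_top)
      refine ⟨K, hK, fun n => (hPle _).trans ?_⟩
      rw [Measure.smul_apply, smul_eq_mul]
      exact (mul_le_mul_right (hKδ n) _).trans ENNReal.mul_div_le)
  refine ⟨k, κ, hk, hκ, fun H hH ⟨B, hB⟩ ⟨K, hK, hKH⟩ => ?_⟩
  have hB0 : 0 ≤ B := (abs_nonneg _).trans (hB (0, Classical.arbitrary Y))
  -- `g` is bounded below on the compact set carrying `H`, so that `H / g` is bounded.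
  obtain ⟨m, hm, hmg⟩ : ∃ m, 0 < m ∧ ∀ x ∈ K, m ≤ g x :=
    hK.exists_forall_le' hg.continuousOn fun x _ => hg0 x
  have hcont : Continuous fun z : RSpace d × Y => (g z.1)⁻¹ * H z :=
    ((hg.comp continuous_fst).inv₀ fun z => (hg0 z.1).ne').mul hH
  have hbd (z : RSpace d × Y) : ‖(g z.1)⁻¹ * H z‖ ≤ m⁻¹ * B := by
    by_cases hz : z.1 ∈ K
    · rw [norm_mul, norm_inv, Real.norm_of_nonneg (hg0 _).le]
      exact mul_le_mul (inv_anti₀ hm (hmg _ hz)) (hB z) (norm_nonneg _) (by positivity)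
    · have : H z = 0 := hKH z.1 hz z.2
      rw [this]
      simp only [mul_zero, norm_zero]
      positivity
  have hcancel (x : RSpace d) (t : ℝ) : g x * ((g x)⁻¹ * t) = t := by
    rw [mul_inv_cancel_left₀ (hg0 x).ne']
  have key := hlim (BoundedContinuousFunction.ofNormedAddCommGroup _ hcont _ hbd)
  simp only [BoundedContinuousFunction.coe_ofNormedAddCommGroup, hPint, hcancel] at key
  convert key using 2
  rw [Measure.integral_compProd (integrable_compProd_of_bounded κ hH hB hK hKH),
    Measure.integral_compProd (Integrable.of_bound hcont.aestronglyMeasurable _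
      (ae_of_all _ hbd)), hPint]
  simp only [integral_const_mul, hcancel]


theorem continuous_zeroAtInfty_eval {Y : Type*} [TopologicalSpace Y] :
    Continuous fun p : C₀(Y, ℝ) × Y => p.1 p.2 := by
  have h : Continuous fun p : C₀(Y, ℝ) × Y => (p.1.toBCF, p.2) :=
    ((ZeroAtInftyContinuousMap.isometry_toBCF (α := Y) (β := ℝ)).continuous.comp
      continuous_fst).prodMk continuous_snd
  exact (ContinuousEval.continuous_eval (F := BoundedContinuousFunction Y ℝ)).comp h

theorem abs_zeroAtInfty_apply_le {Y : Type*} [TopologicalSpace Y] (u : C₀(Y, ℝ)) (y : Y) :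
    |u y| ≤ ‖u‖ := by
  rw [← ZeroAtInftyContinuousMap.norm_toBCF_eq_norm]
  exact u.toBCF.norm_coe_le_norm y

/-- Evaluation of an integrable `C₀(Y)`-valued map, with respect to a measure on `X × Y` that has
`μ` as first marginal. The measures carried by a graph and the measures `μ ⊗ₘ κ` are both of this
kind. -/
theorem integrable_zeroAtInfty_eval {X Y : Type*} [MeasurableSpace X] [TopologicalSpace Y]
    [SecondCountableTopology Y] [MeasurableSpace Y] [BorelSpace Y]
    [TopologicalSpace.PseudoMetrizableSpace Y]
    {μ : Measure X} {M : Measure (X × Y)} (hM : M.fst = μ) {σ : X → C₀(Y, ℝ)}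
    (hσ : Integrable σ μ) : Integrable (fun z => σ z.1 z.2) M := by
  rw [← hM, Measure.fst] at hσ
  have h1 : Integrable (fun z : X × Y => σ z.1) M := hσ.comp_measurable measurable_fst
  refine h1.norm.mono' ?_ (ae_of_all _ fun z => abs_zeroAtInfty_apply_le _ _)
  exact continuous_zeroAtInfty_eval.comp_aestronglyMeasurable
    (h1.aestronglyMeasurable.prodMk measurable_snd.stronglyMeasurable.aestronglyMeasurable)

theorem abs_integral_zeroAtInfty_eval_sub_le {X Y : Type*} [MeasurableSpace X] [TopologicalSpace Y]
    [SecondCountableTopology Y] [MeasurableSpace Y] [BorelSpace Y]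
    [TopologicalSpace.PseudoMetrizableSpace Y]
    {μ : Measure X} {M : Measure (X × Y)} (hM : M.fst = μ) {σ τ : X → C₀(Y, ℝ)}
    (hσ : Integrable σ μ) (hτ : Integrable τ μ) :
    |∫ z, σ z.1 z.2 ∂M - ∫ z, τ z.1 z.2 ∂M| ≤ ∫ x, ‖σ x - τ x‖ ∂μ := by
  have hd : Integrable (fun x => ‖σ x - τ x‖) μ := (hσ.sub hτ).norm
  rw [← integral_sub (integrable_zeroAtInfty_eval hM hσ) (integrable_zeroAtInfty_eval hM hτ),
    ← hM, Measure.fst]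
  rw [← hM, Measure.fst] at hd
  rw [integral_map (f := fun x => ‖σ x - τ x‖) measurable_fst.aemeasurable hd.aestronglyMeasurable]
  rw [← Real.norm_eq_abs]
  refine norm_integral_le_of_norm_le (hd.comp_measurable measurable_fst)
    (ae_of_all _ fun z => ?_)
  exact abs_zeroAtInfty_apply_le (σ z.1 - τ z.1) z.2

theorem NarrowLimit.isYoungMeasure {d : ℕ} {Y : Type*} [TopologicalSpace Y] [PolishSpace Y]
    [MeasurableSpace Y] [BorelSpace Y] {f : ℕ → RSpace d → Y} {κ : Kernel (RSpace d) Y}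
    [IsMarkovKernel κ] (h : NarrowLimit f κ) (hf : ∀ n, AEMeasurable (f n) volume) :
    IsYoungMeasure f κ := by
  refine ⟨fun x => prob_le_one, fun σ hσ => ?_⟩
  have hM : ((volume : Measure (RSpace d)) ⊗ₘ κ).fst = volume := Measure.fst_compProd _ _
  let G : ℕ → Measure (RSpace d × Y) := fun n => volume.map fun x => (x, f n x)
  have hfg (n : ℕ) : AEMeasurable (fun x => (x, f n x)) volume := aemeasurable_id.prodMk (hf n)
  have hG (n : ℕ) : (G n).fst = volume := by
    simp only [G]
    rw [Measure.fst_map_prodMk₀ (hf n)]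
    exact Measure.map_id
  have hGint {τ : RSpace d → C₀(Y, ℝ)} (hτ : Integrable τ volume) (n : ℕ) :
      ∫ z, τ z.1 z.2 ∂(G n) = ∫ x, τ x (f n x) :=
    integral_map (hfg n) (integrable_zeroAtInfty_eval (hG n) hτ).aestronglyMeasurable
  have hκint : ∫ x, ∫ y, σ x y ∂(κ x) = ∫ z, σ z.1 z.2 ∂(volume ⊗ₘ κ) :=
    (Measure.integral_compProd (integrable_zeroAtInfty_eval hM hσ)).symm
  rw [hκint, Metric.tendsto_atTop]
  intro δ hδ
  obtain ⟨τ, hτs, hτδ, hτc, hτ⟩ :=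
    hσ.exists_hasCompactSupport_integral_sub_le (ε := δ / 3) (by positivity)
  obtain ⟨C, hC⟩ := hτs.exists_bound_of_continuous hτc
  have hlim := h (fun z => τ z.1 z.2)
    (continuous_zeroAtInfty_eval.comp ((hτc.comp continuous_fst).prodMk continuous_snd))
    ⟨C, fun z => (abs_zeroAtInfty_apply_le _ _).trans (hC z.1)⟩
    ⟨tsupport τ, hτs, fun x hx y => by simp [image_eq_zero_of_notMem_tsupport hx]⟩
  obtain ⟨N, hN⟩ := Metric.tendsto_atTop.1 hlim (δ / 3) (by positivity)
  refine ⟨N, fun n hn => ?_⟩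
  have h1 := abs_integral_zeroAtInfty_eval_sub_le (hG n) hσ hτ
  have h2 := abs_integral_zeroAtInfty_eval_sub_le hM hσ hτ
  have h3 := hN n hn
  rw [hGint hσ, hGint hτ] at h1
  rw [Real.dist_eq] at h3 ⊢
  rw [abs_le] at h1 h2
  rw [abs_lt] at h3 ⊢
  constructor <;> linarith

/-! ### Comparison of measures through compactly supported functions -/

theorem measure_le_of_lintegral_compactlySupported_le {X : Type*} [TopologicalSpace X]
    [LocallyCompactSpace X] [PolishSpace X] [MeasurableSpace X] [BorelSpace X]
    {μ ν : Measure X} [IsFiniteMeasure ν]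
    (h : ∀ φ : X → ℝ, Continuous φ → HasCompactSupport φ → (∀ x, 0 ≤ φ x) →
      ∫⁻ x, ENNReal.ofReal (φ x) ∂μ ≤ ∫⁻ x, ENNReal.ofReal (φ x) ∂ν) : μ ≤ ν := by
  have hcomp (K : Set X) (hK : IsCompact K) : μ K ≤ ν K := by
    rw [K.measure_eq_iInf_isOpen ν]
    refine le_iInf₂ fun U hKU => le_iInf fun hU => ?_
    obtain ⟨φ, hφ1, hφ0, hφs, hφ⟩ :=
      exists_continuous_one_zero_of_isCompact hK hU.isClosed_compl
        (disjoint_compl_right_iff_subset.2 hKU)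
    calc μ K = ∫⁻ x, K.indicator 1 x ∂μ := (lintegral_indicator_one hK.measurableSet).symm
      _ ≤ ∫⁻ x, ENNReal.ofReal (φ x) ∂μ := by
          refine lintegral_mono fun x => ?_
          by_cases hx : x ∈ K
          · simp [hx, hφ1 hx]
          · simp [hx]
      _ ≤ ∫⁻ x, ENNReal.ofReal (φ x) ∂ν := h φ φ.continuous hφs fun x => (hφ x).1
      _ ≤ ∫⁻ x, U.indicator 1 x ∂ν := by
          refine lintegral_mono fun x => ?_
          by_cases hx : x ∈ U
          · simpa [hx] using (hφ x).2
          · simp [hx, hφ0 hx]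
      _ = ν U := lintegral_indicator_one hU.measurableSet
  have hfin : IsFiniteMeasure μ := by
    refine ⟨lt_of_le_of_lt ?_ (measure_lt_top ν univ)⟩
    conv_lhs => rw [← iUnion_compactCovering,
      (Monotone.directed_le fun _ _ h => compactCovering_subset X h).measure_iUnion]
    exact iSup_le fun n => (hcomp _ (isCompact_compactCovering X n)).trans
      (measure_mono (subset_univ _))
  refine Measure.le_iff.2 fun s hs => ?_
  rw [hs.measure_eq_iSup_isCompact]
  exact iSup₂_le fun K hKs => iSup_le fun hK => (hcomp K hK).trans (measure_mono hKs)


/-! ### The truncated moment -/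

/-- The function `min(r⁺, K) φ(x, ξ / r)` of `z = (x, r, ξ)`. It vanishes for `r ≤ 0` if `0 ≤ K`,
whatever the value of `ξ / 0`. -/
noncomputable def cutoffMoment {d : ℕ} (φ : RSpace d × RSpace d → ℝ) (K : ℝ)
    (z : RSpace d × (ℝ × RSpace d)) : ℝ :=
  min (max z.2.1 0) K * φ (z.1, z.2.1⁻¹ • z.2.2)

/-- The factor `r⁺` makes the function continuous across `r = 0`, where `ξ / r` is not. -/
theorem continuous_cutoffMoment {d : ℕ} {φ : RSpace d × RSpace d → ℝ} (hφ : Continuous φ) {B : ℝ}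
    (hB : ∀ z, |φ z| ≤ B) {K : ℝ} (hK : 0 ≤ K) : Continuous (cutoffMoment φ K) := by
  refine continuous_iff_continuousAt.2 fun z => ?_
  rcases lt_or_ge 0 z.2.1 with hz | hz
  · unfold cutoffMoment
    refine ContinuousAt.mul (by fun_prop) (hφ.continuousAt.comp ?_)
    have h1 : ContinuousAt (fun w : RSpace d × (ℝ × RSpace d) => w.2.1) z := by fun_prop
    exact continuousAt_fst.prodMk ((h1.inv₀ hz.ne').smul (by fun_prop))
  · have h0 : cutoffMoment φ K z = 0 := by simp [cutoffMoment, max_eq_right hz, hK]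
    rw [ContinuousAt, h0]
    refine squeeze_zero_norm (a := fun w => max w.2.1 0 * B) (fun w => ?_) ?_
    · rw [cutoffMoment, norm_mul, Real.norm_of_nonneg (le_min (le_max_right _ _) hK)]
      exact mul_le_mul (min_le_left _ _) (hB _) (norm_nonneg _) (le_max_right _ _)
    · have : Continuous fun w : RSpace d × (ℝ × RSpace d) => max w.2.1 0 * B := by fun_prop
      simpa [max_eq_right hz] using this.tendsto z

theorem cutoffMoment_nonneg {d : ℕ} {φ : RSpace d × RSpace d → ℝ} (hφ : ∀ z, 0 ≤ φ z) {K : ℝ}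
    (hK : 0 ≤ K) (z : RSpace d × (ℝ × RSpace d)) : 0 ≤ cutoffMoment φ K z :=
  mul_nonneg (le_min (le_max_right _ _) hK) (hφ _)

theorem abs_cutoffMoment_le {d : ℕ} {φ : RSpace d × RSpace d → ℝ} {B : ℝ}
    (hB : ∀ z, |φ z| ≤ B) {K : ℝ} (hK : 0 ≤ K) (z : RSpace d × (ℝ × RSpace d)) :
    |cutoffMoment φ K z| ≤ K * B := by
  rw [cutoffMoment, abs_mul, abs_of_nonneg (le_min (le_max_right _ _) hK)]
  exact mul_le_mul (min_le_right _ _) (hB _) (abs_nonneg _) hK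

theorem cutoffMoment_eq_zero {d : ℕ} {φ : RSpace d × RSpace d → ℝ} (K : ℝ) {x : RSpace d}
    (hx : x ∉ Prod.fst '' tsupport φ) (y : ℝ × RSpace d) : cutoffMoment φ K (x, y) = 0 := by
  have : φ (x, y.1⁻¹ • y.2) = 0 :=
    image_eq_zero_of_notMem_tsupport fun h => hx ⟨_, h, rfl⟩
  simp [cutoffMoment, this]

theorem integrable_cutoffMoment {d : ℕ} (μ : Kernel (RSpace d) (ℝ × RSpace d)) [IsMarkovKernel μ]
    {φ : RSpace d × RSpace d → ℝ} (hφ : Continuous φ) (hφs : HasCompactSupport φ) {K : ℝ}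
    (hK : 0 ≤ K) : Integrable (cutoffMoment φ K) (volume ⊗ₘ μ) := by
  obtain ⟨B, hB⟩ := hφs.exists_bound_of_continuous hφ
  exact integrable_compProd_of_bounded μ (continuous_cutoffMoment hφ hB hK)
    (abs_cutoffMoment_le hB hK) (hφs.image continuous_fst) fun _ hx => cutoffMoment_eq_zero K hx

theorem NarrowLimit.tendsto_cutoffMoment {d : ℕ} {f : ℕ → RSpace d → ℝ × RSpace d}
    {μ : Kernel (RSpace d) (ℝ × RSpace d)} (h : NarrowLimit f μ)
    {φ : RSpace d × RSpace d → ℝ} (hφ : Continuous φ) (hφs : HasCompactSupport φ) {K : ℝ}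
    (hK : 0 ≤ K) : Tendsto (fun n => ∫ x, cutoffMoment φ K (x, f n x)) atTop
      (𝓝 (∫ z, cutoffMoment φ K z ∂(volume ⊗ₘ μ))) := by
  obtain ⟨B, hB⟩ := hφs.exists_bound_of_continuous hφ
  exact h _ (continuous_cutoffMoment hφ hB hK) ⟨_, abs_cutoffMoment_le hB hK⟩
    ⟨_, hφs.image continuous_fst, fun _ hx => cutoffMoment_eq_zero K hx⟩

theorem lintegral_youngMoment {d : ℕ} (μ : Kernel (RSpace d) (ℝ × RSpace d)) [IsMarkovKernel μ]
    {φ : RSpace d × RSpace d → ℝ} (hφ : Continuous φ) (hφ0 : ∀ z, 0 ≤ φ z) :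
    ∫⁻ z, ENNReal.ofReal (φ z) ∂(youngMoment μ) =
      ⨆ N : ℕ, ∫⁻ z, ENNReal.ofReal (cutoffMoment φ N z) ∂(volume ⊗ₘ μ) := by
  have hq : Measurable fun z : RSpace d × (ℝ × RSpace d) => (z.1, z.2.1⁻¹ • z.2.2) := by
    fun_prop
  have hm (N : ℕ) : Measurable fun z => ENNReal.ofReal (cutoffMoment φ N z) := by
    unfold cutoffMoment
    exact (Measurable.mul (by fun_prop) (hφ.measurable.comp hq)).ennreal_ofReal
  have hφm : Measurable fun z => ENNReal.ofReal (φ z) := by fun_prop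
  have hden : ∫⁻ z, ENNReal.ofReal (φ (z.1, z.2.1⁻¹ • z.2.2))
        ∂((volume ⊗ₘ μ).withDensity fun z => ENNReal.ofReal z.2.1) =
      ∫⁻ z, ENNReal.ofReal z.2.1 * ENNReal.ofReal (φ (z.1, z.2.1⁻¹ • z.2.2)) ∂(volume ⊗ₘ μ) :=
    lintegral_withDensity_eq_lintegral_mul _ (by fun_prop) (hφm.comp hq)
  rw [youngMoment, lintegral_map hφm hq,
    hden, ← lintegral_iSup hm]
  · refine lintegral_congr fun z => ?_
    have h0 : ENNReal.ofReal z.2.1 = ENNReal.ofReal (max z.2.1 0) := by simp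
    have hle (N : ℕ) : cutoffMoment φ N z ≤ max z.2.1 0 * φ (z.1, z.2.1⁻¹ • z.2.2) :=
      mul_le_mul_of_nonneg_right (min_le_left _ _) (hφ0 _)
    rw [h0, ← ENNReal.ofReal_mul (le_max_right _ _)]
    refine le_antisymm ?_ (iSup_le fun N => ENNReal.ofReal_le_ofReal (hle N))
    obtain ⟨N, hN⟩ := exists_nat_ge (max z.2.1 0)
    refine le_iSup_of_le N (le_of_eq ?_)
    rw [cutoffMoment, min_eq_left hN]
  · intro N N' hN z
    refine ENNReal.ofReal_le_ofReal (mul_le_mul_of_nonneg_right ?_ (hφ0 _))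
    exact min_le_min_left _ (by exact_mod_cast hN)

/-- The limit `β` of the measures `∫ ρₙ φ(x, Jₙ / ρₙ) dx` dominates the moment of the Young measure,
since truncating the density decreases the integral. -/
theorem lintegral_youngMoment_le {d : ℕ} {ρ : ℕ → RSpace d → ℝ} {J : ℕ → RSpace d → RSpace d}
    {μ : Kernel (RSpace d) (ℝ × RSpace d)} [IsMarkovKernel μ]
    (hlim : NarrowLimit (fun n x => (ρ n x, J n x)) μ) (hρ0 : ∀ n x, 0 ≤ ρ n x)
    {φ : RSpace d × RSpace d → ℝ} (hφ : Continuous φ) (hφs : HasCompactSupport φ)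
    (hφ0 : ∀ z, 0 ≤ φ z)
    (hint : ∀ n, Integrable (fun x => ρ n x * φ (x, (ρ n x)⁻¹ • J n x)) volume)
    {β : Measure (RSpace d × RSpace d)} [IsFiniteMeasure β]
    (hβ : Tendsto (fun n => ∫ x, ρ n x * φ (x, (ρ n x)⁻¹ • J n x)) atTop (𝓝 (∫ z, φ z ∂β))) :
    ∫⁻ z, ENNReal.ofReal (φ z) ∂(youngMoment μ) ≤ ∫⁻ z, ENNReal.ofReal (φ z) ∂β := by
  rw [lintegral_youngMoment μ hφ hφ0]
  refine iSup_le fun N => ?_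
  rw [← ofReal_integral_eq_lintegral_ofReal
      (integrable_cutoffMoment μ hφ hφs N.cast_nonneg)
      (ae_of_all _ (cutoffMoment_nonneg hφ0 N.cast_nonneg)),
    ← ofReal_integral_eq_lintegral_ofReal (hφ.integrable_of_hasCompactSupport hφs)
      (ae_of_all _ hφ0)]
  refine ENNReal.ofReal_le_ofReal
    (le_of_tendsto_of_tendsto' (hlim.tendsto_cutoffMoment hφ hφs N.cast_nonneg) hβ fun n => ?_)
  refine integral_mono_of_nonneg
    (ae_of_all _ fun x => cutoffMoment_nonneg hφ0 N.cast_nonneg _) (hint n)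
    (ae_of_all _ fun x => ?_)
  refine mul_le_mul_of_nonneg_right ?_ (hφ0 _)
  exact (min_le_left _ _).trans_eq (max_eq_left (hρ0 n x))

/-- The converse inequality holds when large values of `ρₙ` carry uniformly little mass. -/
theorem lintegral_le_lintegral_youngMoment {d : ℕ} {ρ : ℕ → RSpace d → ℝ}
    {J : ℕ → RSpace d → RSpace d}
    {μ : Kernel (RSpace d) (ℝ × RSpace d)} [IsMarkovKernel μ]
    (hlim : NarrowLimit (fun n x => (ρ n x, J n x)) μ) (hρ0 : ∀ n x, 0 ≤ ρ n x)
    (hρ : ∀ n, Integrable (ρ n) volume) (hJ : ∀ n, AEMeasurable (J n) volume)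
    (hui : ∀ η : ℝ, 0 < η → ∃ N : ℕ, ∀ᶠ n in atTop, ∫ x in {x | (N : ℝ) < ρ n x}, ρ n x ≤ η)
    {φ : RSpace d × RSpace d → ℝ} (hφ : Continuous φ) (hφs : HasCompactSupport φ)
    (hφ0 : ∀ z, 0 ≤ φ z)
    {β : Measure (RSpace d × RSpace d)} [IsFiniteMeasure β]
    (hβ : Tendsto (fun n => ∫ x, ρ n x * φ (x, (ρ n x)⁻¹ • J n x)) atTop (𝓝 (∫ z, φ z ∂β))) :
    ∫⁻ z, ENNReal.ofReal (φ z) ∂β ≤ ∫⁻ z, ENNReal.ofReal (φ z) ∂(youngMoment μ) := by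
  -- The bound is made positive, as `η` is divided by it.
  obtain ⟨B', hB'⟩ := hφs.exists_bound_of_continuous hφ
  obtain ⟨B, hB0, hB⟩ : ∃ B : ℝ, 0 < B ∧ ∀ z, |φ z| ≤ B :=
    ⟨max B' 1, by positivity, fun z => (hB' z).trans (le_max_left _ _)⟩
  rw [← ofReal_integral_eq_lintegral_ofReal (hφ.integrable_of_hasCompactSupport hφs)
      (ae_of_all _ hφ0)]
  refine ENNReal.le_of_forall_pos_le_add fun η hη _ => ?_
  obtain ⟨N, hN⟩ := hui (η / B) (by positivity)
  have hK : (0 : ℝ) ≤ N := N.cast_nonneg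
  have hle : ∫ z, φ z ∂β ≤ ∫ z, cutoffMoment φ N z ∂(volume ⊗ₘ μ) + η := by
    refine le_of_tendsto_of_tendsto hβ ((hlim.tendsto_cutoffMoment hφ hφs hK).add_const _)
      (hN.mono fun n hn => ?_)
    have hset : NullMeasurableSet {x | (N : ℝ) < ρ n x} volume :=
      nullMeasurableSet_lt aemeasurable_const (hρ n).aemeasurable
    have hi1 : Integrable (fun x => cutoffMoment φ N (x, ρ n x, J n x)) volume := by
      refine ((hρ n).mul_const B).mono' ?_ (ae_of_all _ fun x => ?_)
      · exact ((continuous_cutoffMoment hφ hB hK).measurable.comp_aemeasurable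
          (aemeasurable_id.prodMk ((hρ n).aemeasurable.prodMk (hJ n)))).aestronglyMeasurable
      · rw [cutoffMoment, norm_mul, Real.norm_of_nonneg (le_min (le_max_right _ _) hK)]
        refine mul_le_mul ?_ (hB _) (norm_nonneg _) (hρ0 n x)
        exact (min_le_left _ _).trans_eq (max_eq_left (hρ0 n x))
    have hi2 : Integrable ({x | (N : ℝ) < ρ n x}.indicator (ρ n)) volume :=
      (hρ n).indicator₀ hset
    calc ∫ x, ρ n x * φ (x, (ρ n x)⁻¹ • J n x)
        ≤ ∫ x, (cutoffMoment φ N (x, ρ n x, J n x)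
            + {x | (N : ℝ) < ρ n x}.indicator (ρ n) x * B) := by
          refine integral_mono_of_nonneg (ae_of_all _ fun x => mul_nonneg (hρ0 n x) (hφ0 _))
            (hi1.add (hi2.mul_const B)) (ae_of_all _ fun x => ?_)
          have h1 : 0 ≤ cutoffMoment φ N (x, ρ n x, J n x) := cutoffMoment_nonneg hφ0 hK _
          by_cases hx : (N : ℝ) < ρ n x
          · have h2 : ρ n x * φ (x, (ρ n x)⁻¹ • J n x) ≤ ρ n x * B :=
              mul_le_mul_of_nonneg_left ((le_abs_self _).trans (hB _)) (hρ0 n x)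
            simpa [hx] using h2.trans (le_add_of_nonneg_left h1)
          · simp [hx, cutoffMoment, max_eq_left (hρ0 n x), min_eq_left (not_lt.1 hx)]
      _ = (∫ x, cutoffMoment φ N (x, ρ n x, J n x)) +
          (∫ x in {x | (N : ℝ) < ρ n x}, ρ n x) * B := by
          rw [integral_add hi1 (hi2.mul_const B), integral_mul_const, integral_indicator₀ hset]
      _ ≤ (∫ x, cutoffMoment φ N (x, ρ n x, J n x)) + η := by
          gcongr
          exact (le_div_iff₀ hB0).1 hn
  calc ENNReal.ofReal (∫ z, φ z ∂β)
      ≤ ENNReal.ofReal (∫ z, cutoffMoment φ N z ∂(volume ⊗ₘ μ) + η) :=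
        ENNReal.ofReal_le_ofReal hle
    _ ≤ ENNReal.ofReal (∫ z, cutoffMoment φ N z ∂(volume ⊗ₘ μ)) + η :=
        ENNReal.ofReal_add_le.trans (by simp)
    _ ≤ _ := by
        gcongr
        rw [lintegral_youngMoment μ hφ hφ0, ofReal_integral_eq_lintegral_ofReal
          (integrable_cutoffMoment μ hφ hφs hK) (ae_of_all _ (cutoffMoment_nonneg hφ0 hK))]
        exact le_iSup (fun N : ℕ => ∫⁻ z, ENNReal.ofReal (cutoffMoment φ N z) ∂(volume ⊗ₘ μ)) N

/-! ### Equi-integrability of weakly convergent non-negative sequences -/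

/-- A non-negative sequence that converges weakly in `L¹` and is bounded in `L¹` is equi-integrable.
Otherwise there are `n₀ < n₁ < ⋯` such that `ρ` at `n j` has mass more than `η` on
`A j = {2 ^ j < ρ (n j)}`. The measure of `T i = ⋃ j ≥ i, A j` tends to `0` with `i`, while by
non-negativity `ρ` at `n j` has mass more than `η` on `T i` for all `j ≥ i`. Testing weak
convergence with the indicator of `T i` gives mass at least `η` of the limit on every `T i`. -/
theorem TendstoWeakL1.exists_setIntegral_le {d : ℕ} {ρ : ℕ → RSpace d → ℝ} {ρ₀ : RSpace d → ℝ}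
    (h : TendstoWeakL1 ρ ρ₀) (hρ0 : ∀ n x, 0 ≤ ρ n x) {C : ℝ≥0∞} (hC : C ≠ ⊤)
    (hρC : ∀ n, ∫⁻ x, ENNReal.ofReal (ρ n x) ≤ C) {η : ℝ} (hη : 0 < η) :
    ∃ N : ℕ, ∀ᶠ n in atTop, ∫ x in {x | (N : ℝ) < ρ n x}, ρ n x ≤ η := by
  obtain ⟨hint, hint0, hlim⟩ := h
  by_contra! hcon
  obtain ⟨n, hn, hnη⟩ := extraction_forall_of_frequently
    (P := fun j n => η < ∫ x in {x | ((2 ^ j : ℕ) : ℝ) < ρ n x}, ρ n x) fun j => by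
      simpa [not_le] using hcon (2 ^ j)
  let A : ℕ → Set (RSpace d) := fun j => {x | ((2 ^ j : ℕ) : ℝ) < ρ (n j) x}
  have hA (j : ℕ) : NullMeasurableSet (A j) volume :=
    nullMeasurableSet_lt aemeasurable_const (hint _).aemeasurable
  have hAvol (j : ℕ) : volume (A j) ≤ C * 2⁻¹ ^ j := by
    calc volume (A j) ≤ volume {x | (2 : ℝ≥0∞) ^ j ≤ ENNReal.ofReal (ρ (n j) x)} := by
          refine measure_mono fun x hx => ?_
          have : (2 : ℝ≥0∞) ^ j = ENNReal.ofReal ((2 ^ j : ℕ) : ℝ) := by simp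
          rw [mem_ofPred_eq, this]
          exact ENNReal.ofReal_le_ofReal (le_of_lt hx)
      _ ≤ (∫⁻ x, ENNReal.ofReal (ρ (n j) x)) / 2 ^ j :=
          meas_ge_le_lintegral_div (hint _).aemeasurable.ennreal_ofReal (by simp) (by simp)
      _ ≤ C * 2⁻¹ ^ j := by
          rw [div_eq_mul_inv, ENNReal.inv_pow]
          gcongr
          exact hρC _
  let T : ℕ → Set (RSpace d) := fun i => ⋃ j, A (j + i)
  have hT (i : ℕ) : NullMeasurableSet (T i) volume := .iUnion fun j => hA _
  have hTvol : Tendsto (volume ∘ T) atTop (𝓝 0) := by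
    refine tendsto_of_tendsto_of_tendsto_of_le_of_le tendsto_const_nhds
      (ENNReal.tendsto_sum_nat_add (fun j => C * 2⁻¹ ^ j) ?_) (fun _ => zero_le) fun i =>
        (measure_iUnion_le _).trans (ENNReal.tsum_le_tsum fun j => hAvol _)
    rw [ENNReal.tsum_mul_left, ENNReal.tsum_geometric]
    exact ENNReal.mul_ne_top hC (by simp)
  have hTη (i : ℕ) : η ≤ ∫ x in T i, ρ₀ x := by
    have hind (u : RSpace d → ℝ) : ∫ x, u x * (T i).indicator 1 x = ∫ x in T i, u x := by
      rw [← integral_indicator₀ (hT i)]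
      congr 1 with x
      by_cases hx : x ∈ T i <;> simp [hx]
    have hg : MemLp ((T i).indicator (1 : RSpace d → ℝ)) ⊤ volume := by
      refine memLp_top_of_bound (aestronglyMeasurable_one.indicator₀ (hT i)) 1
        (ae_of_all _ fun x => ?_)
      by_cases hx : x ∈ T i <;> simp [hx]
    have hl := (hlim _ hg).comp hn.tendsto_atTop
    simp only [Function.comp_def, hind] at hl
    refine ge_of_tendsto hl ((eventually_ge_atTop i).mono fun j hj => (hnη j).le.trans ?_)
    refine setIntegral_mono_set (hint _).integrableOn (ae_of_all _ (hρ0 _)) ?_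
    refine LE.le.eventuallyLE (fun x hx => mem_iUnion.2 ⟨j - i, ?_⟩)
    rw [Nat.sub_add_cancel hj]
    exact hx
  exact absurd (ge_of_tendsto' (hint0.tendsto_setIntegral_nhds_zero hTvol) hTη) (not_le.2 hη)


/-! ### Density and current -/

theorem MemH1.memLp_weakGradient {d : ℕ} {ψ : RSpace d → ℂ} (hψ : MemH1 ψ) :
    MemLp (weakGradient ψ) 2 volume := by
  rw [weakGradient, dif_pos hψ.2]
  exact hψ.2.choose_spec.1

theorem density_nonneg {d : ℕ} (ψ : RSpace d → ℂ) (x : RSpace d) : 0 ≤ density ψ x := by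
  unfold density
  positivity

theorem MemH1.integrable_density {d : ℕ} {ψ : RSpace d → ℂ} (hψ : MemH1 ψ) :
    Integrable (density ψ) volume := hψ.1.integrable_norm_pow (by simp)

theorem MemH1.aemeasurable_current {d : ℕ} {ψ : RSpace d → ℂ} (hψ : MemH1 ψ) (ε : ℝ) :
    AEMeasurable (current ε ψ) volume := by
  have h1 : AEMeasurable ψ volume := hψ.1.aestronglyMeasurable.aemeasurable
  have h2 : AEMeasurable (weakGradient ψ) volume :=
    hψ.memLp_weakGradient.aestronglyMeasurable.aemeasurable
  have h3 : Measurable fun p : ℂ × EuclideanSpace ℂ (Fin d) =>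
      (WithLp.toLp 2 fun j => ε * (starRingEnd ℂ p.1 * p.2 j).im : RSpace d) := by
    apply Continuous.measurable
    fun_prop
  exact h3.comp_aemeasurable (h1.prodMk h2)

theorem norm_current_le {d : ℕ} (ε : ℝ) (ψ : RSpace d → ℂ) (x : RSpace d) :
    ‖current ε ψ x‖ ≤ ‖ψ x‖ * ‖(ε : ℂ) • weakGradient ψ x‖ := by
  rw [← norm_smul, EuclideanSpace.norm_eq, EuclideanSpace.norm_eq]
  refine Real.sqrt_le_sqrt (Finset.sum_le_sum fun j _ => ?_)
  refine pow_le_pow_left₀ (norm_nonneg _) ?_ 2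
  simp only [current, PiLp.smul_apply, smul_eq_mul, norm_mul]
  have h := Complex.abs_im_le_norm (starRingEnd ℂ (ψ x) * weakGradient ψ x j)
  rw [norm_mul, RCLike.norm_conj] at h
  rw [Complex.norm_real, mul_left_comm]
  exact mul_le_mul_of_nonneg_left h (norm_nonneg _)

theorem lintegral_enorm_sq_eq {d : ℕ} {E : Type*} [NormedAddCommGroup E] (u : RSpace d → E) :
    ∫⁻ x, ‖u x‖ₑ ^ 2 = eLpNorm u 2 volume ^ 2 := by
  simpa using (eLpNorm_nnreal_pow_eq_lintegral (μ := volume) (f := u) (p := 2) (by simp)).symm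

theorem MemH1.lintegral_enorm_density_current_le {d : ℕ} {ψ : RSpace d → ℂ} (hψ : MemH1 ψ)
    (ε : ℝ) : ∫⁻ x, ‖(density ψ x, current ε ψ x)‖ₑ ≤ 2 * H1epsNorm ε ψ ^ 2 := by
  have hpt (x : RSpace d) : ‖(density ψ x, current ε ψ x)‖ₑ ≤
      ‖ψ x‖ₑ ^ 2 + ‖(ε : ℂ) • weakGradient ψ x‖ₑ ^ 2 := by
    have h1 := norm_current_le ε ψ x
    have h2 : ‖density ψ x‖ = ‖ψ x‖ ^ 2 := Real.norm_of_nonneg (density_nonneg ψ x)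
    have h3 : ‖(density ψ x, current ε ψ x)‖ ≤
        ‖ψ x‖ ^ 2 + ‖(ε : ℂ) • weakGradient ψ x‖ ^ 2 := by
      rw [Prod.norm_mk, max_le_iff, h2]
      constructor <;>
        nlinarith [sq_nonneg (‖ψ x‖ - ‖(ε : ℂ) • weakGradient ψ x‖), sq_nonneg ‖ψ x‖,
          sq_nonneg ‖(ε : ℂ) • weakGradient ψ x‖]
    simp only [← ofReal_norm]
    rw [← ENNReal.ofReal_pow (norm_nonneg _), ← ENNReal.ofReal_pow (norm_nonneg _),
      ← ENNReal.ofReal_add (by positivity) (by positivity)]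
    exact ENNReal.ofReal_le_ofReal h3
  calc ∫⁻ x, ‖(density ψ x, current ε ψ x)‖ₑ
      ≤ ∫⁻ x, (‖ψ x‖ₑ ^ 2 + ‖(ε : ℂ) • weakGradient ψ x‖ₑ ^ 2) := lintegral_mono hpt
    _ = eLpNorm ψ 2 volume ^ 2 + eLpNorm (fun x => (ε : ℂ) • weakGradient ψ x) 2 volume ^ 2 := by
        rw [lintegral_add_left' (hψ.1.aestronglyMeasurable.enorm.pow_const 2),
          lintegral_enorm_sq_eq, lintegral_enorm_sq_eq]
    _ ≤ H1epsNorm ε ψ ^ 2 + H1epsNorm ε ψ ^ 2 := by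
        gcongr
        · exact le_self_add
        · exact le_add_self
    _ = 2 * H1epsNorm ε ψ ^ 2 := (two_mul _).symm

theorem integral_bohmianMeasure {d : ℕ} {ψ : RSpace d → ℂ} (hψ : MemH1 ψ) (ε : ℝ)
    {φ : RSpace d × RSpace d → ℝ} (hφ : Continuous φ) :
    ∫ z, φ z ∂(bohmianMeasure ε ψ) =
      ∫ x, density ψ x * φ (x, (density ψ x)⁻¹ • current ε ψ x) := by
  have hρ : AEMeasurable (density ψ) volume := hψ.integrable_density.aemeasurable
  have hq : AEMeasurable (fun x => (x, (density ψ x)⁻¹ • current ε ψ x)) volume :=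
    aemeasurable_id.prodMk (hρ.inv.smul (hψ.aemeasurable_current ε))
  rw [bohmianMeasure, integral_map (hq.mono_ac (withDensity_absolutelyContinuous _ _))
    hφ.aestronglyMeasurable, integral_withDensity_eq_integral_toReal_smul₀ hρ.ennreal_ofReal
    (by simp)]
  simp [ENNReal.toReal_ofReal (density_nonneg ψ _)]

/-- Markov's inequality: a sequence bounded in `L¹` has tight values. -/
theorem exists_isCompact_volume_notMem_le {d : ℕ} {E : Type*} [NormedAddCommGroup E]
    [ProperSpace E] [MeasurableSpace E] [BorelSpace E] {f : ℕ → RSpace d → E}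
    (hf : ∀ n, AEMeasurable (f n) volume) {C : ℝ≥0∞} (hC : C ≠ ⊤)
    (hfC : ∀ n, ∫⁻ x, ‖f n x‖ₑ ≤ C) {δ : ℝ≥0∞} (hδ : 0 < δ) :
    ∃ K : Set E, IsCompact K ∧ ∀ n, volume {x | f n x ∉ K} ≤ δ := by
  obtain ⟨R, hR0, hR⟩ : ∃ R : ℝ, 0 < R ∧ C / ENNReal.ofReal R ≤ δ := by
    have ht : Tendsto (fun R : ℝ => C / ENNReal.ofReal R) atTop (𝓝 0) := by
      have := ENNReal.Tendsto.const_div (a := C) ENNReal.tendsto_ofReal_atTop (Or.inr hC)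
      simpa using this
    exact ((eventually_gt_atTop 0).and (ht.eventually_le_const hδ)).exists
  refine ⟨Metric.closedBall 0 R, isCompact_closedBall 0 R, fun n => ?_⟩
  calc volume {x | f n x ∉ Metric.closedBall 0 R}
      ≤ volume {x | ENNReal.ofReal R ≤ ‖f n x‖ₑ} := by
        refine measure_mono fun x hx => ?_
        have : R < ‖f n x‖ := by simpa using hx
        rw [mem_ofPred_eq, ← ofReal_norm]
        exact ENNReal.ofReal_le_ofReal this.le
    _ ≤ (∫⁻ x, ‖f n x‖ₑ) / ENNReal.ofReal R :=
        meas_ge_le_lintegral_div (hf n).enorm (by simpa using hR0) ENNReal.ofReal_ne_top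
    _ ≤ C / ENNReal.ofReal R := ENNReal.div_le_div_right (hfC n) _
    _ ≤ δ := hR

end BohmianYoung

theorem lemma3p3 (d : ℕ) (ψ : ℝ → RSpace d → ℂ) (hψ : UniformlyBoundedH1eps ψ)
    (ε : ℕ → ℝ) (hε : ∀ n, ε n ∈ Ioc (0 : ℝ) 1) (hε0 : Tendsto ε atTop (𝓝 0))
    (β : Measure (RSpace d × RSpace d)) (hβfin : IsFiniteMeasure β)
    (hβ : TendstoWeakStar (fun n => bohmianMeasure (ε n) (ψ (ε n))) β) :
    ∃ (k : ℕ → ℕ) (μ : Kernel (RSpace d) (ℝ × RSpace d)),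
      StrictMono k ∧
      IsYoungMeasure
        (fun n x => (density (ψ (ε (k n))) x, current (ε (k n)) (ψ (ε (k n))) x)) μ ∧
      youngMoment μ ≤ β ∧
      ∀ ρ : RSpace d → ℝ, TendstoWeakL1 (fun n => density (ψ (ε (k n)))) ρ →
        β = youngMoment μ ∧ ∀ᵐ x, IsProbabilityMeasure (μ x) := by
  obtain ⟨hH1, hsup⟩ := hψ
  obtain ⟨C, hC, hbd⟩ : ∃ C : ℝ≥0∞, C ≠ ⊤ ∧ ∀ n,
      ∫⁻ x, ‖(density (ψ (ε n)) x, current (ε n) (ψ (ε n)) x)‖ₑ ≤ C := by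
    refine ⟨2 * (⨆ ε ∈ Ioc (0 : ℝ) 1, H1epsNorm ε (ψ ε)) ^ 2,
      ENNReal.mul_ne_top ENNReal.ofNat_ne_top (ENNReal.pow_ne_top hsup.ne), fun n =>
      ((hH1 _ (hε n)).lintegral_enorm_density_current_le (ε n)).trans ?_⟩
    gcongr
    exact le_iSup₂ (f := fun ε (_ : ε ∈ Ioc (0 : ℝ) 1) => H1epsNorm ε (ψ ε)) (ε n) (hε n)
  have hmeas (n : ℕ) : AEMeasurable
      (fun x => (density (ψ (ε n)) x, current (ε n) (ψ (ε n)) x)) volume :=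
    (hH1 _ (hε n)).integrable_density.aemeasurable.prodMk
      ((hH1 _ (hε n)).aemeasurable_current _)
  obtain ⟨k, μ, hk, hμ, hlim⟩ := exists_narrowLimit _ hmeas fun δ hδ =>
    exists_isCompact_volume_notMem_le hmeas hC hbd hδ
  have hφlim {φ : RSpace d × RSpace d → ℝ} (hφ : Continuous φ) (hφs : HasCompactSupport φ) :
      Tendsto (fun n => ∫ x, density (ψ (ε (k n))) x * φ (x, (density (ψ (ε (k n))) x)⁻¹ •
        current (ε (k n)) (ψ (ε (k n))) x)) atTop (𝓝 (∫ z, φ z ∂β)) := by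
    refine ((hβ ⟨⟨φ, hφ⟩, hφs.is_zero_at_infty⟩).comp hk.tendsto_atTop).congr fun n => ?_
    exact integral_bohmianMeasure (hH1 _ (hε _)) _ hφ
  have hle : youngMoment μ ≤ β := by
    refine measure_le_of_lintegral_compactlySupported_le fun φ hφ hφs hφ0 => ?_
    obtain ⟨B, hB⟩ := hφs.exists_bound_of_continuous hφ
    refine lintegral_youngMoment_le hlim (fun n x => density_nonneg _ x) hφ hφs hφ0
      (fun n => ?_) (hφlim hφ hφs)
    have hρ := (hH1 _ (hε (k n))).integrable_density
    have hq := aemeasurable_id.prodMk (hρ.aemeasurable.inv.smul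
      ((hH1 _ (hε (k n))).aemeasurable_current (ε (k n))))
    exact hρ.mul_bdd (c := B) (hφ.measurable.comp_aemeasurable hq).aestronglyMeasurable
      (ae_of_all _ fun x => hB _)
  refine ⟨k, μ, hk, hlim.isYoungMeasure fun n => hmeas (k n), hle, fun ρ hρ =>
    ⟨le_antisymm ?_ hle, ae_of_all _ fun x => inferInstance⟩⟩
  have : IsFiniteMeasure (youngMoment μ) := isFiniteMeasure_of_le β hle
  refine measure_le_of_lintegral_compactlySupported_le fun φ hφ hφs hφ0 => ?_
  refine lintegral_le_lintegral_youngMoment hlim (fun n x => density_nonneg _ x)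
    (fun n => (hH1 _ (hε (k n))).integrable_density)
    (fun n => (hH1 _ (hε (k n))).aemeasurable_current _)
    (fun η hη => hρ.exists_setIntegral_le (fun n x => density_nonneg _ x) hC
      (fun n => (lintegral_mono fun x => ?_).trans (hbd (k n))) hη)
    hφ hφs hφ0 (hφlim hφ hφs)
  rw [← ofReal_norm]
  exact ENNReal.ofReal_le_ofReal ((le_abs_self _).trans
    (norm_fst_le (density (ψ (ε (k n))) x, current _ _ x)))
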